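/- Let $G=(V,E)$ be a finite simple graph with edge weights $w_{ij}=w_{ji}\in[0,1]$ for $(i,j)\in E$ and capacities $b_i\in\{1,2,3,\dots\}$ for $i\in V$. Write $\partial i$ for the set of neighbours of $i$ and $(x)_+=\max(x,0)$. For $b\ge 1$, let $b\text{-}\max$ of a finite family of nonnegative reals denote its $b$-th largest member, counted with multiplicity, or $0$ if the family has fewer than $b$ members. A message vector $\underline\alpha$ consists of a real number $\alpha_{i\backslash j}$ for every ordered pair $(i,j)$ of adjacent vertices ($2|E|$ numbers). It determines the offers $$m_{i\to j}|_{\underline\alpha}=(w_{ij}-\alpha_{i\backslash j})_+-\tfrac12\,(w_{ij}-\alpha_{i\backslash j}-\alpha_{j\backslash i})_+ .$$ Fix $\kappa\in(0,1)$. Given an initial message vector $\underline\alpha^0$, the natural dynamics with capacities $(b_i)$ is the sequence defined for $t=0,1,2,\dots$ by $$\alpha_{i\backslash j}^{t+1}=(1-\kappa)\,\alpha_{i\backslash j}^{t}+\kappa\; b_i\text{-}\max_{k\in\partial i\setminus\{j\}}\; m_{k\to i}|_{\underline\alpha^t}.$$ A message vector $\underline\alpha$ is an $\epsilon$-fixed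 point if $\big|\alpha_{i\backslash j}-b_i\text{-}\max_{k\in\partial i\setminus\{j\}} m_{k\to i}|_{\underline\alpha}\big|\le\epsilon$ for every ordered pair $(i,j)$ of adjacent vertices. Theorem. For every initial condition $\underline\alpha^0\in[0,1]^{2|E|}$ and every $\epsilon>0$, put $$T^*(\epsilon)=\frac{1}{\pi\,\kappa(1-\kappa)\,\epsilon^2}.$$ Then for every integer $t\ge T^*(\epsilon)$, $\underline\alpha^t$ is an $\epsilon$-fixed point. (Here $\pi=3.14159\ldots$) -/

import Mathlib

noncomputable section

namespace Bargaining

/-- The `b`-th largest element (`b ≥ 1`), counted with multiplicity, of a finite family of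
reals; it is `0` if the family has fewer than `b` members. -/
def bMax (b : ℕ) (s : Multiset ℝ) : ℝ :=
  (s.sort (fun x y => x ≥ y)).getD (b - 1) 0

variable {V : Type*} [Fintype V] [DecidableEq V] (G : SimpleGraph V) [DecidableRel G.Adj]

/-- A message vector: one real for every directed edge (`2|E|` coordinates). For the dart
`d = (i, j)`, the coordinate `α d` is the message sent by `i` to `j`, i.e. the best alternative
that `i` estimates if she does not trade with `j`. -/
abbrev Messages : Type _ := G.Dart → ℝ

/-- The offer `m_{i→j} = (w_{ij} - α_{i\j})₊ - ½ (w_{ij} - α_{i\j} - α_{j\i})₊` made along the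
dart `d = (i, j)`. -/
def offer (w : Sym2 V → ℝ) (α : Messages G) (d : G.Dart) : ℝ :=
  max (w d.edge - α d) 0 - (1 / 2) * max (w d.edge - α d - α d.symm) 0

/-- For the dart `d = (i, j)`: the `b_i`-th largest of the offers `m_{k→i}`, where `k` runs over
the neighbours of `i` other than `j`. -/
def bestAlternative (w : Sym2 V → ℝ) (b : V → ℕ) (α : Messages G) (d : G.Dart) : ℝ :=
  bMax (b d.fst)
    ((Finset.univ.filter fun e : G.Dart => e.snd = d.fst ∧ e.fst ≠ d.snd).val.map
      (offer G w α))

/-- The natural dynamics with capacities `b`, damping factor `κ` and initial messages `α₀`. -/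
def naturalDynamics (w : Sym2 V → ℝ) (b : V → ℕ) (κ : ℝ) (α₀ : Messages G) : ℕ → Messages G
  | 0 => α₀
  | t + 1 => fun d =>
      (1 - κ) * naturalDynamics w b κ α₀ t d
        + κ * bestAlternative G w b (naturalDynamics w b κ α₀ t) d

/-- `α` is an `ε`-fixed point: every message is within `ε` of the best alternative computed
from `α`. -/
def IsApproxFixedPoint (w : Sym2 V → ℝ) (b : V → ℕ) (ε : ℝ) (α : Messages G) : Prop :=
  ∀ d : G.Dart, |α d - bestAlternative G w b α d| ≤ ε

end Bargaining

end

namespace Bargaining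

/-! ### Order statistics -/

/-! The map `T = bestAlternative` is nonexpansive for the sup norm and preserves `[0,1]^{2|E|}`, so
the dynamics is the averaged iteration `x (n+1) = (1 - κ) x n + κ T (x n)`, and the claim is the
Baillon–Bruck rate `‖x n - T (x n)‖ ≤ 1 / √(π κ (1 - κ) n)`. The distances `‖x m - x n‖` and `‖x m -
T (x n)‖` obey recursive inequalities whose extremal solution is `E sign (k + Y - X)` at `k = 0, 1`,
with binomial `X`, `Y` (`norm_iterate_sub_le_signAverage`). On the diagonal `m = n`, Fourier
inversion turns the value at `k = 1` into a cosine integral (`signAverage_self_one`), which a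
Gaussian integral dominates with the sharp constant `π` (`signAverage_self_one_le`). -/

theorem le_getElem_iff_of_pairwise_ge {l : List ℝ} (hl : l.Pairwise (· ≥ ·)) {i : ℕ}
    (hi : i < l.length) (c : ℝ) : c ≤ l[i] ↔ i + 1 ≤ l.countP (fun x => decide (c ≤ x)) := by
  induction l generalizing i with
  | nil => simp at hi
  | cons a l ih =>
    rw [List.pairwise_cons] at hl
    cases i with
    | zero =>
      simp only [List.getElem_cons_zero, zero_add]
      constructor
      · intro h
        rw [List.countP_cons_of_pos (by simpa using h)]
        omega
      · intro h
        obtain ⟨x, hx, hcx⟩ := List.countP_pos_iff.1 (Nat.lt_of_lt_of_le Nat.one_pos h)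
        have hcx' : c ≤ x := by simpa using hcx
        rcases List.mem_cons.1 hx with rfl | hx
        · exact hcx'
        · exact hcx'.trans (hl.1 x hx)
    | succ i =>
      have hi' : i < l.length := by simpa using hi
      simp only [List.getElem_cons_succ]
      rw [ih hl.2 hi']
      by_cases hca : c ≤ a
      · rw [List.countP_cons_of_pos (by simpa using hca)]
        omega
      · have h0 : l.countP (fun x => decide (c ≤ x)) = 0 := by
          rw [List.countP_eq_zero]
          intro x hx
          have := hl.1 x hx
          simp only [decide_eq_true_eq, not_le]
          exact lt_of_le_of_lt this (not_le.1 hca)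
        rw [List.countP_cons_of_neg (by simpa using hca), h0]
        omega

theorem le_bMax_iff {b : ℕ} (hb : 1 ≤ b) {s : Multiset ℝ} (hs : b ≤ s.card) (c : ℝ) :
    c ≤ bMax b s ↔ b ≤ s.countP (c ≤ ·) := by
  have hi : b - 1 < (s.sort (fun x y => x ≥ y)).length := by
    rw [Multiset.length_sort]; omega
  have hcount : s.countP (c ≤ ·) =
      (s.sort (fun x y => x ≥ y)).countP (fun x => decide (c ≤ x)) := by
    conv_lhs => rw [← Multiset.sort_eq s (fun x y => x ≥ y)]
    rw [Multiset.coe_countP]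
  rw [bMax, List.getD_eq_getElem _ _ hi,
    le_getElem_iff_of_pairwise_ge (Multiset.pairwise_sort s _) hi, hcount]
  omega

theorem bMax_eq_zero_of_card_lt {b : ℕ} (hb : 1 ≤ b) {s : Multiset ℝ} (hs : s.card < b) :
    bMax b s = 0 := by
  rw [bMax, List.getD_eq_default]
  rw [Multiset.length_sort]; omega

theorem bMax_mem_of_forall_mem {I : Set ℝ} (h0 : (0 : ℝ) ∈ I) (b : ℕ) {s : Multiset ℝ}
    (hs : ∀ x ∈ s, x ∈ I) : bMax b s ∈ I := by
  rw [bMax]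
  by_cases hi : b - 1 < (s.sort (fun x y => x ≥ y)).length
  · rw [List.getD_eq_getElem _ _ hi]
    exact hs _ ((Multiset.mem_sort (· ≥ ·)).1 (List.getElem_mem hi))
  · rw [List.getD_eq_default _ _ (not_lt.1 hi)]
    exact h0

/-- By the counting criterion `le_bMax_iff`: at least `b` indices have `f` above the threshold `bMax
b (s.map f)`, and at these `g` is above the threshold minus `δ`. -/
theorem bMax_map_le_add {ι : Type*} {b : ℕ} (hb : 1 ≤ b) (s : Multiset ι) {f g : ι → ℝ} {δ : ℝ}
    (hδ : 0 ≤ δ) (hfg : ∀ i, f i ≤ g i + δ) : bMax b (s.map f) ≤ bMax b (s.map g) + δ := by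
  rcases lt_or_ge s.card b with hs | hs
  · rw [bMax_eq_zero_of_card_lt hb (by simpa using hs),
      bMax_eq_zero_of_card_lt hb (by simpa using hs)]
    simpa using hδ
  · have hf := (le_bMax_iff hb (by simpa using hs) (bMax b (s.map f))).1 le_rfl
    rw [← sub_le_iff_le_add, le_bMax_iff hb (by simpa using hs)]
    refine hf.trans ?_
    rw [Multiset.countP_map, Multiset.countP_map]
    refine Multiset.card_le_card (Multiset.monotone_filter_right _ fun i hi => ?_)
    linarith [hfg i]

theorem abs_bMax_map_sub_le {ι : Type*} {b : ℕ} (hb : 1 ≤ b) (s : Multiset ι) {f g : ι → ℝ}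
    {δ : ℝ} (hδ : 0 ≤ δ) (hfg : ∀ i, |f i - g i| ≤ δ) :
    |bMax b (s.map f) - bMax b (s.map g)| ≤ δ := by
  rw [abs_sub_le_iff, sub_le_iff_le_add', sub_le_iff_le_add']
  constructor
  · exact bMax_map_le_add hb s hδ fun i => by linarith [(abs_le.1 (hfg i)).2]
  · exact bMax_map_le_add hb s hδ fun i => by linarith [(abs_le.1 (hfg i)).1]

/-! ### The message update map -/

/-- The offer is piecewise linear in its two messages, and on each piece the absolute values of the
two slopes sum to at most 1. -/
theorem abs_offer_sub_le {V : Type*} (G : SimpleGraph V) (w : Sym2 V → ℝ) (α β : Messages G) (d : G.Dart) {δ : ℝ}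
    (h : |α d - β d| ≤ δ) (h' : |α d.symm - β d.symm| ≤ δ) :
    |offer G w α d - offer G w β d| ≤ δ := by
  unfold offer
  rw [abs_le] at h h' ⊢
  generalize w d.edge = W at *
  generalize α d = x at *
  generalize β d = x' at *
  generalize α d.symm = y at *
  generalize β d.symm = y' at *
  obtain ⟨h1, h2⟩ := h
  obtain ⟨h3, h4⟩ := h'
  rcases max_cases (W - x) 0 with ⟨e1, f1⟩ | ⟨e1, f1⟩ <;>
  rcases max_cases (W - x') 0 with ⟨e2, f2⟩ | ⟨e2, f2⟩ <;>
  rcases max_cases (W - x - y) 0 with ⟨e3, f3⟩ | ⟨e3, f3⟩ <;>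
  rcases max_cases (W - x' - y') 0 with ⟨e4, f4⟩ | ⟨e4, f4⟩ <;>
  rw [e1, e2, e3, e4] <;> constructor <;> linarith

theorem offer_mem_Icc {V : Type*} (G : SimpleGraph V) {w : Sym2 V → ℝ} {α : Messages G} (d : G.Dart)
    (hw : w d.edge ∈ Set.Icc (0 : ℝ) 1) (hα : ∀ e, α e ∈ Set.Icc (0 : ℝ) 1) :
    offer G w α d ∈ Set.Icc (0 : ℝ) 1 := by
  obtain ⟨h1, h2⟩ := hα d
  obtain ⟨h3, h4⟩ := hα d.symm
  obtain ⟨h5, h6⟩ := hw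
  unfold offer
  rcases max_cases (w d.edge - α d) 0 with ⟨e1, f1⟩ | ⟨e1, f1⟩ <;>
  rcases max_cases (w d.edge - α d - α d.symm) 0 with ⟨e3, f3⟩ | ⟨e3, f3⟩ <;>
  rw [e1, e3] <;> constructor <;> linarith

section Update

variable {V : Type*} [Fintype V] [DecidableEq V] (G : SimpleGraph V) [DecidableRel G.Adj]

theorem norm_bestAlternative_sub_le (w : Sym2 V → ℝ) {b : V → ℕ} (hb : ∀ i, 1 ≤ b i)
    (α β : Messages G) :
    ‖bestAlternative G w b α - bestAlternative G w b β‖ ≤ ‖α - β‖ := by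
  rw [pi_norm_le_iff_of_nonneg (norm_nonneg _)]
  intro d
  exact abs_bMax_map_sub_le (hb _) _ (norm_nonneg _) fun e =>
    abs_offer_sub_le G w α β e (norm_le_pi_norm (α - β) e) (norm_le_pi_norm (α - β) e.symm)

theorem bestAlternative_mem_Icc {w : Sym2 V → ℝ} (hw : ∀ e ∈ G.edgeSet, w e ∈ Set.Icc (0 : ℝ) 1)
    (b : V → ℕ) {α : Messages G} (hα : ∀ e, α e ∈ Set.Icc (0 : ℝ) 1) (d : G.Dart) :
    bestAlternative G w b α d ∈ Set.Icc (0 : ℝ) 1 := by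
  refine bMax_mem_of_forall_mem (I := Set.Icc (0 : ℝ) 1) ⟨le_rfl, zero_le_one⟩ _ fun x hx => ?_
  obtain ⟨e, -, rfl⟩ := Multiset.mem_map.1 hx
  exact offer_mem_Icc G e (hw _ e.edge_mem) hα

theorem naturalDynamics_mem_Icc {w : Sym2 V → ℝ} (hw : ∀ e ∈ G.edgeSet, w e ∈ Set.Icc (0 : ℝ) 1)
    (b : V → ℕ) {κ : ℝ} (hκ : κ ∈ Set.Icc (0 : ℝ) 1) {α₀ : Messages G}
    (hα₀ : ∀ d, α₀ d ∈ Set.Icc (0 : ℝ) 1) (t : ℕ) (d : G.Dart) :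
    naturalDynamics G w b κ α₀ t d ∈ Set.Icc (0 : ℝ) 1 := by
  induction t generalizing d with
  | zero => exact hα₀ d
  | succ t ih =>
    exact convex_Icc (0 : ℝ) 1 (ih d) (bestAlternative_mem_Icc G hw b ih d)
      (sub_nonneg.2 hκ.2) hκ.1 (sub_add_cancel 1 κ)

end Update

/-! ### Averages of the sign function on `ℤ` -/

/-- The average of `f` over the points `k` and `k + s` with weights `1 - κ` and `κ`. -/
noncomputable def shiftAverage (κ : ℝ) (s : ℤ) (f : ℤ → ℝ) (k : ℤ) : ℝ :=
  (1 - κ) * f k + κ * f (k + s)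

theorem shiftAverage_commute (κ : ℝ) (s r : ℤ) :
    Function.Commute (shiftAverage κ s) (shiftAverage κ r) := by
  intro f
  funext k
  simp only [shiftAverage, add_right_comm k r s]
  ring

/-- The expectation of `sign (k + Y - X)` for independent binomial variables `Y` and `X` with
parameters `(n, κ)` and `(m, κ)`. -/
noncomputable def signAverage (κ : ℝ) (m n : ℕ) : ℤ → ℝ :=
  (shiftAverage κ (-1))^[m] ((shiftAverage κ 1)^[n] fun k => ((SignType.sign k : SignType) : ℝ))

theorem signAverage_succ_left (κ : ℝ) (m n : ℕ) (k : ℤ) :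
    signAverage κ (m + 1) n k =
      (1 - κ) * signAverage κ m n k + κ * signAverage κ m n (k - 1) := by
  rw [signAverage, Function.iterate_succ_apply']
  rfl

theorem signAverage_succ_right (κ : ℝ) (m n : ℕ) (k : ℤ) :
    signAverage κ m (n + 1) k =
      (1 - κ) * signAverage κ m n k + κ * signAverage κ m n (k + 1) := by
  rw [signAverage, Function.iterate_succ_apply',
    ((shiftAverage_commute κ (-1) 1).iterate_left m).eq]
  rfl

theorem signAverage_succ_succ (κ : ℝ) (n : ℕ) (k : ℤ) :
    signAverage κ (n + 1) (n + 1) k = (1 - 2 * (κ * (1 - κ))) * signAverage κ n n k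
      + κ * (1 - κ) * (signAverage κ n n (k + 1) + signAverage κ n n (k - 1)) := by
  rw [signAverage_succ_left, signAverage_succ_right, signAverage_succ_right, sub_add_cancel]
  ring

theorem signAverage_zero_of_pos (κ : ℝ) (n : ℕ) {k : ℤ} (hk : 0 < k) :
    signAverage κ 0 n k = 1 := by
  induction n generalizing k with
  | zero => simp [signAverage, sign_pos hk]
  | succ n ih =>
    rw [signAverage_succ_right, ih hk, ih (by omega)]
    ring

theorem signAverage_neg (κ : ℝ) (n : ℕ) (k : ℤ) :
    signAverage κ n n (-k) = -signAverage κ n n k := by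
  induction n generalizing k with
  | zero => simp [signAverage, Left.sign_neg]
  | succ n ih =>
    rw [signAverage_succ_succ, signAverage_succ_succ, ih, show -k + 1 = -(k - 1) by ring,
      show -k - 1 = -(k + 1) by ring, ih, ih]
    ring

theorem signAverage_self_zero (κ : ℝ) (n : ℕ) : signAverage κ n n 0 = 0 := by
  have := signAverage_neg κ n 0
  rw [neg_zero] at this
  linarith

theorem integral_cos_int_mul (k : ℤ) :
    ∫ θ in (-Real.pi)..Real.pi, Real.cos (k * θ) = if k = 0 then 2 * Real.pi else 0 := by
  split_ifs with h
  · subst h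
    simp
    ring
  · have hk : (k : ℝ) ≠ 0 := by exact_mod_cast h
    rw [intervalIntegral.integral_comp_mul_left (fun x => Real.cos x) hk, integral_cos]
    simp [Real.sin_int_mul_pi]

/-- The left side is 2 at `k = 0`, 1 at `k = ±1` and 0 elsewhere: the Fourier coefficients of `1 +
cos θ`. -/
theorem sign_add_one_sub_sign_sub_one (k : ℤ) :
    ((SignType.sign (k + 1) : SignType) : ℝ) - ((SignType.sign (k - 1) : SignType) : ℝ) =
      (1 / Real.pi) * ∫ θ in (-Real.pi)..Real.pi, (1 + Real.cos θ) * Real.cos (k * θ) := by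
  have hexp : ∀ θ : ℝ, (1 + Real.cos θ) * Real.cos (k * θ) = Real.cos (k * θ) +
      (1 / 2) * (Real.cos ((k + 1 : ℤ) * θ) + Real.cos ((k - 1 : ℤ) * θ)) := by
    intro θ
    push_cast
    rw [add_mul (k : ℝ), sub_mul (k : ℝ), one_mul, Real.cos_add, Real.cos_sub]
    ring
  simp only [hexp]
  have hi : ∀ j : ℤ, IntervalIntegrable (fun θ : ℝ => Real.cos (j * θ)) MeasureTheory.volume
      (-Real.pi) Real.pi := fun j => Continuous.intervalIntegrable (by fun_prop) _ _
  rw [intervalIntegral.integral_add (hi k) (((hi _).add (hi _)).const_mul _),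
    intervalIntegral.integral_const_mul, intervalIntegral.integral_add (hi _) (hi _),
    integral_cos_int_mul, integral_cos_int_mul, integral_cos_int_mul]
  have hpi := Real.pi_ne_zero
  rcases lt_trichotomy k 0 with h | rfl | h
  · rcases eq_or_lt_of_le (show k ≤ -1 by omega) with rfl | h'
    · simp
    · rw [sign_neg (by omega : k + 1 < 0), sign_neg (by omega : k - 1 < 0), if_neg (by omega),
        if_neg (by omega), if_neg (by omega)]
      simp
  · simp
    field_simp
    norm_num
  · rcases eq_or_lt_of_le (show 1 ≤ k by omega) with rfl | h'
    · simp
    · rw [sign_pos (by omega : 0 < k + 1), sign_pos (by omega : 0 < k - 1), if_neg (by omega),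
        if_neg (by omega), if_neg (by omega)]
      simp

/-- The base of the power is `|1 - κ + κ e^{iθ}|²`, the characteristic function of one step of `Y -
X`. -/
theorem signAverage_add_one_sub_sub_one (κ : ℝ) (n : ℕ) (k : ℤ) :
    signAverage κ n n (k + 1) - signAverage κ n n (k - 1) =
      (1 / Real.pi) * ∫ θ in (-Real.pi)..Real.pi,
        (1 - 2 * (κ * (1 - κ)) * (1 - Real.cos θ)) ^ n * (1 + Real.cos θ) * Real.cos (k * θ) := by
  induction n generalizing k with
  | zero => simpa [signAverage] using sign_add_one_sub_sign_sub_one k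
  | succ n ih =>
    set F : ℤ → ℝ → ℝ := fun j θ =>
      (1 - 2 * (κ * (1 - κ)) * (1 - Real.cos θ)) ^ n * (1 + Real.cos θ) * Real.cos (j * θ)
    have hi : ∀ j, IntervalIntegrable (F j) MeasureTheory.volume (-Real.pi) Real.pi :=
      fun j => Continuous.intervalIntegrable (by fun_prop) _ _
    have hF : ∀ θ : ℝ, (1 - 2 * (κ * (1 - κ)) * (1 - Real.cos θ)) ^ (n + 1) * (1 + Real.cos θ)
        * Real.cos (k * θ) = (1 - 2 * (κ * (1 - κ))) * F k θ
          + κ * (1 - κ) * (F (k + 1) θ + F (k - 1) θ) := by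
      intro θ
      simp only [F]
      push_cast
      rw [add_mul (k : ℝ), sub_mul (k : ℝ), one_mul, Real.cos_add, Real.cos_sub]
      ring
    simp only [hF]
    rw [intervalIntegral.integral_add ((hi k).const_mul _) (((hi _).add (hi _)).const_mul _),
      intervalIntegral.integral_const_mul, intervalIntegral.integral_const_mul,
      intervalIntegral.integral_add (hi _) (hi _)]
    have e0 := ih k
    have e1 := ih (k + 1)
    have e2 := ih (k - 1)
    rw [signAverage_succ_succ, signAverage_succ_succ]
    rw [add_sub_cancel_right] at e1 ⊢
    rw [sub_add_cancel] at e2 ⊢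
    linear_combination (1 - 2 * (κ * (1 - κ))) * e0 + κ * (1 - κ) * (e1 + e2)

theorem signAverage_self_one (κ : ℝ) (n : ℕ) :
    signAverage κ n n 1 = (1 / (2 * Real.pi)) * ∫ θ in (-Real.pi)..Real.pi,
        (1 - 2 * (κ * (1 - κ)) * (1 - Real.cos θ)) ^ n * (1 + Real.cos θ) := by
  -- At `k = 0` oddness makes the left side twice the value at 1.
  have h := signAverage_add_one_sub_sub_one κ n 0
  simp only [zero_add, zero_sub, signAverage_neg, Int.cast_zero, zero_mul, Real.cos_zero,
    mul_one] at h
  rw [one_div_mul_eq_div] at h ⊢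
  rw [eq_div_iff Real.pi_ne_zero] at h
  rw [eq_div_iff (by positivity)]
  linarith

theorem integral_exp_neg_sq_le {c : ℝ} (hc : 0 < c) :
    ∫ s in (-1 : ℝ)..1, Real.exp (-c * s ^ 2) ≤ √(Real.pi / c) := by
  rw [← integral_gaussian, intervalIntegral.integral_of_le (by norm_num)]
  exact MeasureTheory.setIntegral_le_integral (integrable_exp_neg_mul_sq hc)
    (Filter.Eventually.of_forall fun _ => (Real.exp_pos _).le)

/-- Substitution `s = sin (θ / 2)`. -/
theorem integral_exp_neg_sin_half_sq (c : ℝ) :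
    ∫ θ in (-Real.pi)..Real.pi, Real.exp (-c * Real.sin (θ / 2) ^ 2) * (Real.cos (θ / 2) / 2) =
      ∫ s in (-1 : ℝ)..1, Real.exp (-c * s ^ 2) := by
  have h := intervalIntegral.integral_comp_mul_deriv (a := -Real.pi) (b := Real.pi)
    (f := fun θ => Real.sin (θ / 2)) (f' := fun θ => Real.cos (θ / 2) / 2)
    (g := fun s => Real.exp (-c * s ^ 2))
    (fun θ _ => by simpa [div_eq_mul_inv] using ((hasDerivAt_id θ).div_const 2).sin)
    (by fun_prop) (by fun_prop)
  simpa [neg_div] using h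

theorem signAverage_self_one_le {κ : ℝ} (hκ : κ ∈ Set.Ioo (0 : ℝ) 1) {n : ℕ} (hn : 0 < n) :
    signAverage κ n n 1 ≤ 1 / √(Real.pi * κ * (1 - κ) * n) := by
  set p := κ * (1 - κ) with hp
  have hp0 : 0 < p := mul_pos hκ.1 (sub_pos.2 hκ.2)
  -- Keeps the base `1 - 4 p sin² (θ / 2)` nonnegative, so that its bound by an exponential can be
  -- raised to the power `n`.
  have hp1 : 4 * p ≤ 1 := by nlinarith [sq_nonneg (1 - 2 * κ)]
  have hn' : (0 : ℝ) < n := by exact_mod_cast hn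
  have hpi := Real.pi_pos
  have hle : ∀ θ ∈ Set.Icc (-Real.pi) Real.pi,
      (1 - 2 * p * (1 - Real.cos θ)) ^ n * (1 + Real.cos θ) ≤
        4 * (Real.exp (-(4 * p * n) * Real.sin (θ / 2) ^ 2) * (Real.cos (θ / 2) / 2)) := by
    intro θ hθ
    have hcos : 0 ≤ Real.cos (θ / 2) :=
      Real.cos_nonneg_of_mem_Icc ⟨by linarith [hθ.1], by linarith [hθ.2]⟩
    have hdouble : Real.cos θ = 2 * Real.cos (θ / 2) ^ 2 - 1 := by
      rw [← Real.cos_two_mul, mul_div_cancel₀ θ two_ne_zero]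
    have hsq := Real.sin_sq_add_cos_sq (θ / 2)
    have hbase : 1 - 2 * p * (1 - Real.cos θ) = 1 - 4 * p * Real.sin (θ / 2) ^ 2 := by
      rw [hdouble]; linear_combination 4 * p * hsq
    have hnonneg : 0 ≤ 1 - 4 * p * Real.sin (θ / 2) ^ 2 := by
      nlinarith [Real.sin_sq_le_one (θ / 2), sq_nonneg (Real.sin (θ / 2))]
    have hpow : (1 - 4 * p * Real.sin (θ / 2) ^ 2) ^ n ≤
        Real.exp (-(4 * p * n) * Real.sin (θ / 2) ^ 2) := by
      refine (pow_le_pow_left₀ hnonneg (Real.one_sub_le_exp_neg _) n).trans_eq ?_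
      rw [← Real.exp_nat_mul]
      ring_nf
    -- `1 + cos θ = 2 cos² (θ / 2)`; giving up one factor `cos (θ / 2) ≤ 1` leaves the Jacobian of
    -- the substitution.
    have hcos' : 1 + Real.cos θ ≤ 2 * Real.cos (θ / 2) := by
      nlinarith [Real.cos_le_one (θ / 2)]
    rw [hbase]
    calc _ ≤ Real.exp (-(4 * p * n) * Real.sin (θ / 2) ^ 2) * (2 * Real.cos (θ / 2)) :=
          mul_le_mul hpow hcos' (by linarith [Real.neg_one_le_cos θ]) (Real.exp_pos _).le
      _ = _ := by ring
  have hint := intervalIntegral.integral_mono_on (by linarith : -Real.pi ≤ Real.pi)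
    (μ := MeasureTheory.volume) (Continuous.intervalIntegrable (by fun_prop) _ _)
    (Continuous.intervalIntegrable (by fun_prop) _ _) hle
  rw [intervalIntegral.integral_const_mul, integral_exp_neg_sin_half_sq] at hint
  have hgauss := integral_exp_neg_sq_le (c := 4 * p * n) (by positivity)
  rw [signAverage_self_one]
  have hroot : 1 / (2 * Real.pi) * (4 * √(Real.pi / (4 * p * n))) =
      1 / √(Real.pi * κ * (1 - κ) * n) := by
    rw [show Real.pi / (4 * p * n) = (Real.pi / 2) ^ 2 / (Real.pi * κ * (1 - κ) * n) by
      rw [hp]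
      have := hκ.1.ne'
      have := (sub_pos.2 hκ.2).ne'
      field_simp
      norm_num, Real.sqrt_div (by positivity), Real.sqrt_sq (by positivity)]
    field_simp
    norm_num
  rw [← hroot]
  exact mul_le_mul_of_nonneg_left (hint.trans (by linarith)) (by positivity)

/-! ### Averaged iterations of a nonexpansive map -/

section Iteration

variable {E : Type*} [NormedAddCommGroup E] [NormedSpace ℝ E]

/-- Expanding `x (n+1)` in the first distance and `x (m+1)` in the second gives the recursions of
`signAverage` in `n` and `m`; nonexpansiveness brings `‖T (x m) - T (x n)‖` back to the first
distance, so only `k = 0, 1` occur. -/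
theorem norm_iterate_sub_le_signAverage {T : E → E} (hT : ∀ x y, ‖T x - T y‖ ≤ ‖x - y‖)
    {κ : ℝ} (hκ : κ ∈ Set.Icc (0 : ℝ) 1) {x : ℕ → E}
    (hx : ∀ n, x (n + 1) = (1 - κ) • x n + κ • T (x n)) (h0 : ∀ n, ‖x 0 - T (x n)‖ ≤ 1)
    {m n : ℕ} (hmn : m ≤ n) :
    ‖x m - x n‖ ≤ signAverage κ m n 0 ∧ ‖x m - T (x n)‖ ≤ signAverage κ m n 1 := by
  have hκ0 := hκ.1
  have hκ1 : 0 ≤ 1 - κ := sub_nonneg.2 hκ.2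
  have hcomb : ∀ u v : E, ‖(1 - κ) • u + κ • v‖ ≤ (1 - κ) * ‖u‖ + κ * ‖v‖ := fun u v => by
    refine (norm_add_le _ _).trans_eq ?_
    rw [norm_smul, norm_smul, Real.norm_of_nonneg hκ0, Real.norm_of_nonneg hκ1]
  induction hs : m + n using Nat.strong_induction_on generalizing m n with
  | _ s ih =>
    constructor
    · rcases eq_or_lt_of_le hmn with rfl | hlt
      · rw [sub_self, norm_zero, signAverage_self_zero]
      · obtain ⟨n, rfl⟩ : ∃ l, n = l + 1 := ⟨n - 1, by omega⟩
        obtain ⟨hA, hB⟩ := ih (m + n) (by omega) (by omega : m ≤ n) rfl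
        rw [signAverage_succ_right, zero_add, hx,
          show x m - ((1 - κ) • x n + κ • T (x n)) =
            (1 - κ) • (x m - x n) + κ • (x m - T (x n)) by module]
        refine (hcomb _ _).trans ?_
        gcongr
    · rcases m with _ | m
      · rw [signAverage_zero_of_pos κ n one_pos]
        exact h0 n
      · obtain ⟨hA, hB⟩ := ih (m + n) (by omega) (by omega : m ≤ n) rfl
        rw [signAverage_succ_left, sub_self, hx,
          show (1 - κ) • x m + κ • T (x m) - T (x n) =
            (1 - κ) • (x m - T (x n)) + κ • (T (x m) - T (x n)) by module]
        refine (hcomb _ _).trans ?_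
        have := (hT (x m) (x n)).trans hA
        gcongr

/-- The Baillon–Bruck rate of asymptotic regularity for averaged iterations. -/
theorem norm_iterate_sub_map_le {T : E → E} (hT : ∀ x y, ‖T x - T y‖ ≤ ‖x - y‖)
    {κ : ℝ} (hκ : κ ∈ Set.Ioo (0 : ℝ) 1) {x : ℕ → E}
    (hx : ∀ n, x (n + 1) = (1 - κ) • x n + κ • T (x n)) (h0 : ∀ n, ‖x 0 - T (x n)‖ ≤ 1)
    {n : ℕ} (hn : 0 < n) :
    ‖x n - T (x n)‖ ≤ 1 / √(Real.pi * κ * (1 - κ) * n) :=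
  (norm_iterate_sub_le_signAverage hT (Set.Ioo_subset_Icc_self hκ) hx h0 le_rfl).2.trans
    (signAverage_self_one_le hκ hn)

end Iteration

end Bargaining

theorem mainTheorem11 {V : Type*} [Fintype V] [DecidableEq V]
    (G : SimpleGraph V) [DecidableRel G.Adj]
    (w : Sym2 V → ℝ) (hw : ∀ e ∈ G.edgeSet, w e ∈ Set.Icc (0 : ℝ) 1)
    (b : V → ℕ) (hb : ∀ i, 1 ≤ b i)
    (κ : ℝ) (hκ : κ ∈ Set.Ioo (0 : ℝ) 1)
    (α₀ : Bargaining.Messages G) (hα₀ : ∀ d, α₀ d ∈ Set.Icc (0 : ℝ) 1)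
    (ε : ℝ) (hε : 0 < ε)
    (t : ℕ) (ht : 1 / (Real.pi * κ * (1 - κ) * ε ^ 2) ≤ (t : ℝ)) :
    Bargaining.IsApproxFixedPoint G w b ε (Bargaining.naturalDynamics G w b κ α₀ t) := by
  have hκ0 := hκ.1
  have hκ1 : 0 < 1 - κ := sub_pos.2 hκ.2
  have hpos : 0 < 1 / (Real.pi * κ * (1 - κ) * ε ^ 2) := by positivity
  have ht0 : (0 : ℝ) < t := hpos.trans_le ht
  have hmem := Bargaining.naturalDynamics_mem_Icc G hw b (Set.Ioo_subset_Icc_self hκ) hα₀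
  have hnorm := Bargaining.norm_iterate_sub_map_le (Bargaining.norm_bestAlternative_sub_le G w hb)
    hκ (x := Bargaining.naturalDynamics G w b κ α₀) (fun _ => rfl)
    -- Both points lie in the unit cube, whose sup-norm diameter is at most 1.
    (fun n => (pi_norm_le_iff_of_nonneg zero_le_one).2 fun d => by
      obtain ⟨h1, h2⟩ := hmem 0 d
      obtain ⟨h3, h4⟩ := Bargaining.bestAlternative_mem_Icc G hw b (hmem n) d
      rw [Pi.sub_apply, Real.norm_eq_abs, abs_le]
      constructor <;> linarith)
    (Nat.cast_pos.1 ht0)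
  have hrate : 1 / √(Real.pi * κ * (1 - κ) * t) ≤ ε := by
    rw [div_le_iff₀ (by positivity)] at ht
    rw [div_le_iff₀ (by positivity), ← Real.sqrt_sq hε.le, ← Real.sqrt_mul (sq_nonneg ε),
      Real.one_le_sqrt]
    linarith
  exact fun d => (norm_le_pi_norm _ d).trans (hnorm.trans hrate)
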